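/- Let $P_0,P_1$ be the transition matrices of two irreducible aperiodic Markov chains on $n\ge 1$ states, and for $t\in[0,1]$ let $P_t=(1-t)P_0+tP_1$, with (unique) stationary distribution $\pi_t$. Write $\|x\|_{TV}=\frac12\sum_i|x_i|$ for the total variation norm of a difference of probability distributions. For $\varepsilon>0$ let $t_{mix}(P,\varepsilon)$ be the smallest integer $T\ge1$ such that $\|\nu P^T-\pi\|_{TV}\le\varepsilon$ for all probability distributions $\nu$, where $\pi$ is the stationary distribution of $P$; let $t_{mix}(\varepsilon)=\sup_{s\in[0,1]}t_{mix}(P_s,\varepsilon)$; and let the stable adiabatic time $t_{sad}(P_0,P_1,\varepsilon)$ be the smallest integer $T\ge1$ such that $\|\pi_0P_{1/T}P_{2/T}\cdots P_{k/T}-\pi_{k/T}\|_{TV}<\varepsilon$ for all $1\le k\le T$. Then $\pi_t$ exists and is unique for every $t\in[0,1]$, the quantities $t_{mix}(\varepsilon/2)$ and $t_{sad}(P_0,P_1,\varepsilon)$ are finite for every $\varepsilon>0$, and $$t_{sad}(P_0,P_1,\varepsilon)=O\!\left(\frac{t_{mix}^4(\varepsilon/2)}{\varepsilon^3}\right),$$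 that is, for every $\varepsilon_0>0$ there is a constant $C>0$, depending only on $\varepsilon_0$ (not on $n$, $P_0$, $P_1$), such that $t_{sad}(P_0,P_1,\varepsilon)\le C\,t_{mix}^4(\varepsilon/2)/\varepsilon^3$ for all $0<\varepsilon\le\varepsilon_0$. Explicitly, for all $0<\varepsilon\le 1$ (in particular as $\varepsilon\to0$), $$t_{sad}(P_0,P_1,\varepsilon)\le\frac{4\,t_{mix}^4(\varepsilon/2)}{\varepsilon^3}+\frac{4\,t_{mix}^2(\varepsilon/2)}{\varepsilon^2}+\frac1\varepsilon .$$ -/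

import Mathlib

open scoped Matrix

/-- The transition matrix of an irreducible and aperiodic Markov chain on a finite state space:
a row-stochastic matrix which is irreducible and all of whose states have period one. -/
structure IsIrreducibleAperiodic {S : Type*} [Fintype S] [DecidableEq S] (P : Matrix S S ℝ) :
    Prop where
  stochastic : P ∈ Matrix.rowStochastic ℝ S
  irreducible : P.IsIrreducible
  aperiodic : ∀ i : S, Nat.setGcd {m : ℕ | 0 < m ∧ 0 < (P ^ m) i i} = 1

/-- `π` is a stationary probability distribution (a row vector) of `P`. -/
def IsStationaryDist {S : Type*} [Fintype S] (P : Matrix S S ℝ) (π : S → ℝ) : Prop :=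
  π ∈ stdSimplex ℝ S ∧ π ᵥ* P = π

/-- The stationary distribution of `P` (meaningful when it exists and is unique). -/
noncomputable def stationaryDist {S : Type*} [Fintype S] (P : Matrix S S ℝ) : S → ℝ :=
  Classical.epsilon (IsStationaryDist P)

/-- Total variation norm of a difference of two probability distributions:
half of the `ℓ¹` norm. -/
noncomputable def tvNorm {S : Type*} [Fintype S] (x : S → ℝ) : ℝ :=
  (∑ i, |x i|) / 2

/-- The mixing time: the least positive integer `T` such that `‖ν P ^ T - π‖_TV ≤ ε` for all
probability distributions `ν`; it is `⊤` if there is no such `T`. -/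
noncomputable def mixingTime {S : Type*} [Fintype S] [DecidableEq S]
    (P : Matrix S S ℝ) (ε : ℝ) : ℕ∞ :=
  sInf ((fun T : ℕ => (T : ℕ∞)) '' {T : ℕ | 0 < T ∧
    ∀ ν ∈ stdSimplex ℝ S, tvNorm (ν ᵥ* P ^ T - stationaryDist P) ≤ ε})

/-- The interpolated transition matrix `P_t = (1 - t) P₀ + t P₁`. -/
def interpMatrix {S : Type*} (P₀ P₁ : Matrix S S ℝ) (t : ℝ) : Matrix S S ℝ :=
  (1 - t) • P₀ + t • P₁

/-- The supremum of the mixing times of `P_s` over `s ∈ [0, 1]`. -/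
noncomputable def maxMixingTime {S : Type*} [Fintype S] [DecidableEq S]
    (P₀ P₁ : Matrix S S ℝ) (ε : ℝ) : ℕ∞ :=
  ⨆ s ∈ Set.Icc (0 : ℝ) 1, mixingTime (interpMatrix P₀ P₁ s) ε

/-- The distribution `π₀ P_{1/T} P_{2/T} ⋯ P_{k/T}`. -/
noncomputable def adiabaticDist {S : Type*} [Fintype S]
    (P₀ P₁ : Matrix S S ℝ) (T : ℕ) : ℕ → S → ℝ
  | 0 => stationaryDist P₀
  | k + 1 => adiabaticDist P₀ P₁ T k ᵥ* interpMatrix P₀ P₁ (((k + 1 : ℕ) : ℝ) / (T : ℝ))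

/-- The stable adiabatic time: the least positive integer `T` such that
`‖π₀ P_{1/T} ⋯ P_{k/T} - π_{k/T}‖_TV < ε` for `1 ≤ k ≤ T`; it is `⊤` if there is no such `T`. -/
noncomputable def stableAdiabaticTime {S : Type*} [Fintype S]
    (P₀ P₁ : Matrix S S ℝ) (ε : ℝ) : ℕ∞ :=
  sInf ((fun T : ℕ => (T : ℕ∞)) '' {T : ℕ | 0 < T ∧
    ∀ k : ℕ, 1 ≤ k → k ≤ T →
      tvNorm (adiabaticDist P₀ P₁ T k
        - stationaryDist (interpMatrix P₀ P₁ ((k : ℝ) / (T : ℝ)))) < ε})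

/-!
Fix `ε` and let `m` be the maximal mixing time for `ε / 2`. Any distribution pushed through `m`
steps of the *fixed* chain `P_{k/T}` lands within `ε / 2` of `π_{k/T}`. The last `m` steps of the
adiabatic evolution up to time `k` use the matrices `P_{(k-m+1)/T}, …, P_{k/T}` instead, and
replacing one `P_a` by `P_b` moves a distribution by at most `|a - b|`
(`tvNorm_vecMul_interpMatrix_sub_le`). The total replacement error is at most
`∑_{j < m} j / T = m (m - 1) / (2 T)` (`tvNorm_adiabaticDist_sub_le`). When `k < m`, the missing
steps are supplied for free, because `π₀ P₀ = π₀`: the evolution may be taken to have been running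
with the matrix `P₀` before time `0`. Hence every `T > m (m - 1) / ε` is adiabatically stable,
which is stronger than the asserted bounds.

That `π_s` exists and is unique and that `m` is finite follows from a Doeblin condition uniform
in `s`. Irreducibility and aperiodicity make a power of each `P_i` entrywise positive
(`IsIrreducibleAperiodic.exists_forall_ge_pow_pos`), and each `P_s` dominates half of `P₀` or half
of `P₁`, so that for some `N` all entries of all `P_s ^ N` are at least a common `δ > 0`
(`exists_le_interpMatrix_pow`). A matrix with this property contracts the total variation norm on
vectors of sum zero (`tvNorm_vecMul_le_of_le`).
-/

section

variable {S : Type*} [Fintype S]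

/-! ### The total variation norm and stochastic matrices -/

lemma tvNorm_nonneg (x : S → ℝ) : 0 ≤ tvNorm x :=
  div_nonneg (Finset.sum_nonneg fun _ _ => abs_nonneg _) (by norm_num)

lemma tvNorm_add_le (x y : S → ℝ) : tvNorm (x + y) ≤ tvNorm x + tvNorm y := by
  unfold tvNorm
  rw [← add_div, ← Finset.sum_add_distrib]
  gcongr with i
  exact abs_add_le _ _

lemma tvNorm_smul (c : ℝ) (x : S → ℝ) : tvNorm (c • x) = |c| * tvNorm x := by
  simp only [tvNorm, Pi.smul_apply, smul_eq_mul, abs_mul, ← Finset.mul_sum, mul_div_assoc]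

lemma eq_zero_of_tvNorm_le_zero {x : S → ℝ} (hx : tvNorm x ≤ 0) : x = 0 := by
  have h : ∑ i, |x i| ≤ 0 := by unfold tvNorm at hx; linarith
  funext i
  have hi := Finset.single_le_sum (f := fun i => |x i|) (fun i _ => abs_nonneg _)
    (Finset.mem_univ i)
  exact abs_nonpos_iff.1 (hi.trans h)

lemma continuous_tvNorm : Continuous (tvNorm : (S → ℝ) → ℝ) := by
  unfold tvNorm
  fun_prop

lemma tvNorm_sub_le_one {μ ν : S → ℝ} (hμ : μ ∈ stdSimplex ℝ S) (hν : ν ∈ stdSimplex ℝ S) :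
    tvNorm (μ - ν) ≤ 1 := by
  have h : ∑ i, |(μ - ν) i| ≤ ∑ i, (μ i + ν i) := Finset.sum_le_sum fun i _ => by
    rw [Pi.sub_apply, abs_le]
    constructor <;> linarith [hμ.1 i, hν.1 i]
  rw [Finset.sum_add_distrib, hμ.2, hν.2] at h
  unfold tvNorm
  linarith

lemma sum_sub_eq_zero {μ ν : S → ℝ} (hμ : μ ∈ stdSimplex ℝ S) (hν : ν ∈ stdSimplex ℝ S) :
    ∑ i, (μ - ν) i = 0 := by
  simp [hμ.2, hν.2]

lemma isStationaryDist_stationaryDist {P : Matrix S S ℝ} (h : ∃! π, IsStationaryDist P π) :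
    IsStationaryDist P (stationaryDist P) :=
  Classical.epsilon_spec h.exists

variable [DecidableEq S]

lemma sum_vecMul_of_mem_rowStochastic {M : Matrix S S ℝ} (hM : M ∈ Matrix.rowStochastic ℝ S)
    (x : S → ℝ) : ∑ j, (x ᵥ* M) j = ∑ i, x i := by
  simp only [Matrix.vecMul, dotProduct]
  rw [Finset.sum_comm]
  simp [← Finset.mul_sum, Matrix.sum_row_of_mem_rowStochastic hM]

lemma vecMul_mem_stdSimplex {M : Matrix S S ℝ} (hM : M ∈ Matrix.rowStochastic ℝ S)
    {ν : S → ℝ} (hν : ν ∈ stdSimplex ℝ S) : ν ᵥ* M ∈ stdSimplex ℝ S :=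
  ⟨Matrix.nonneg_vecMul_of_mem_rowStochastic hM hν.1,
    (sum_vecMul_of_mem_rowStochastic hM ν).trans hν.2⟩

/-- Doeblin's contraction: subtracting the constant `δ` from every entry does not change the
action of `M` on vectors of sum zero, and leaves a nonnegative matrix with smaller row sums. -/
lemma tvNorm_vecMul_le_of_le {M : Matrix S S ℝ} (hM : M ∈ Matrix.rowStochastic ℝ S) {δ : ℝ}
    (hδ : ∀ i j, δ ≤ M i j) {x : S → ℝ} (hx : ∑ i, x i = 0) :
    tvNorm (x ᵥ* M) ≤ (1 - Fintype.card S * δ) * tvNorm x := by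
  have key : ∀ j, |(x ᵥ* M) j| ≤ ∑ i, |x i| * (M i j - δ) := fun j => by
    have : (x ᵥ* M) j = ∑ i, x i * (M i j - δ) := by
      simp [Matrix.vecMul, dotProduct, mul_sub, Finset.sum_sub_distrib, ← Finset.sum_mul, hx]
    rw [this]
    refine (Finset.abs_sum_le_sum_abs _ _).trans_eq (Finset.sum_congr rfl fun i _ => ?_)
    rw [abs_mul, abs_of_nonneg (sub_nonneg.2 (hδ i j))]
  have h : ∑ j, |(x ᵥ* M) j| ≤ (1 - Fintype.card S * δ) * ∑ i, |x i| := by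
    refine (Finset.sum_le_sum fun j _ => key j).trans_eq ?_
    rw [Finset.sum_comm, Finset.mul_sum]
    refine Finset.sum_congr rfl fun i _ => ?_
    rw [← Finset.mul_sum, Finset.sum_sub_distrib, Matrix.sum_row_of_mem_rowStochastic hM i]
    simp [mul_comm]
  unfold tvNorm
  linarith

lemma tvNorm_vecMul_le {M : Matrix S S ℝ} (hM : M ∈ Matrix.rowStochastic ℝ S) (x : S → ℝ) :
    tvNorm (x ᵥ* M) ≤ tvNorm x := by
  have key : ∀ j, |(x ᵥ* M) j| ≤ ∑ i, |x i| * M i j := fun j => by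
    refine (Finset.abs_sum_le_sum_abs _ _).trans_eq (Finset.sum_congr rfl fun i _ => ?_)
    rw [abs_mul, abs_of_nonneg (hM.1 i j)]
  have h : ∑ j, |(x ᵥ* M) j| ≤ ∑ i, |x i| := by
    refine (Finset.sum_le_sum fun j _ => key j).trans_eq ?_
    exact sum_vecMul_of_mem_rowStochastic hM fun i => |x i|
  unfold tvNorm
  linarith

/-! ### Positive powers and stationary distributions -/

lemma pow_mul_pow_apply_le {A B : Matrix S S ℝ} {c : ℝ} (hc : 0 ≤ c) (hA : ∀ i j, 0 ≤ A i j)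
    (hAB : ∀ i j, c * A i j ≤ B i j) (N : ℕ) (i j : S) :
    c ^ N * (A ^ N) i j ≤ (B ^ N) i j := by
  induction N generalizing i j with
  | zero => simp
  | succ N ih =>
    rw [pow_succ A, pow_succ B, Matrix.mul_apply, Matrix.mul_apply, Finset.mul_sum]
    refine Finset.sum_le_sum fun k _ => ?_
    have hAN : 0 ≤ c ^ N * (A ^ N) i k :=
      mul_nonneg (pow_nonneg hc N) (Matrix.pow_apply_nonneg hA N i k)
    calc c ^ (N + 1) * ((A ^ N) i k * A k j) = (c ^ N * (A ^ N) i k) * (c * A k j) := by ring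
      _ ≤ (B ^ N) i k * B k j :=
        mul_le_mul (ih i k) (hAB k j) (mul_nonneg hc (hA k j)) (hAN.trans (ih i k))

lemma pow_add_apply_pos {A : Matrix S S ℝ} (hA : ∀ i j, 0 ≤ A i j) {a b : ℕ} {i j k : S}
    (h₁ : 0 < (A ^ a) i j) (h₂ : 0 < (A ^ b) j k) : 0 < (A ^ (a + b)) i k := by
  rw [pow_add, Matrix.mul_apply]
  exact Finset.sum_pos' (fun l _ => mul_nonneg (Matrix.pow_apply_nonneg hA a i l)
    (Matrix.pow_apply_nonneg hA b l k)) ⟨j, Finset.mem_univ j, mul_pos h₁ h₂⟩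

/-- Irreducible aperiodic chains are primitive: the return times to a state form an additive
semigroup of gcd one, which therefore contains all large integers. -/
lemma IsIrreducibleAperiodic.exists_forall_ge_pow_pos {P : Matrix S S ℝ}
    (hP : IsIrreducibleAperiodic P) : ∃ N, ∀ k ≥ N, ∀ i j, 0 < (P ^ k) i j := by
  have hnn := hP.irreducible.nonneg
  have hret : ∀ i, ∃ n, ∀ m ≥ n, 0 < (P ^ m) i i := fun i => by
    obtain ⟨n, hn⟩ := Nat.exists_mem_closure_of_ge {m : ℕ | 0 < m ∧ 0 < (P ^ m) i i}
    refine ⟨n, fun m hm => ?_⟩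
    refine AddSubmonoid.closure_induction (motive := fun m _ => 0 < (P ^ m) i i)
      (fun a ha => ha.2) (by simp) (fun a b _ _ ha hb => pow_add_apply_pos hnn ha hb)
      (hn m hm ?_)
    rw [hP.aperiodic i]
    exact one_dvd m
  choose n hn using hret
  choose d _ hd using (Matrix.isIrreducible_iff_exists_pow_pos hnn).1 hP.irreducible
  refine ⟨∑ i, n i + ∑ i, ∑ j, d i j, fun k hk i j => ?_⟩
  have h₁ : n i ≤ ∑ i, n i := Finset.single_le_sum (fun _ _ => Nat.zero_le _) (Finset.mem_univ i)
  have h₂ : d i j ≤ ∑ j, d i j :=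
    Finset.single_le_sum (fun _ _ => Nat.zero_le _) (Finset.mem_univ j)
  have h₃ : ∑ j, d i j ≤ ∑ i, ∑ j, d i j :=
    Finset.single_le_sum (f := fun i => ∑ j, d i j) (fun _ _ => Nat.zero_le _) (Finset.mem_univ i)
  have h := pow_add_apply_pos hnn (hn i (k - d i j) (by omega)) (hd i j)
  rwa [Nat.sub_add_cancel (by omega)] at h

/-- A minimizer `x` of `‖x P - x‖` over the simplex is stationary, since passing from `x` to
`x P ^ N` would strictly decrease a positive minimum. -/
lemma existsUnique_isStationaryDist [Nonempty S] {P : Matrix S S ℝ}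
    (hP : P ∈ Matrix.rowStochastic ℝ S) {N : ℕ} {δ : ℝ} (hδ : 0 < δ)
    (hN : ∀ i j, δ ≤ (P ^ N) i j) : ∃! π : S → ℝ, IsStationaryDist P π := by
  have hPN : P ^ N ∈ Matrix.rowStochastic ℝ S := pow_mem hP N
  have hcard : 0 < (Fintype.card S : ℝ) * δ := mul_pos (by exact_mod_cast Fintype.card_pos) hδ
  have hzero : ∀ x : S → ℝ, ∑ i, x i = 0 → tvNorm x ≤ tvNorm (x ᵥ* P ^ N) → x = 0 := by
    intro x hx hle
    have h := tvNorm_vecMul_le_of_le hPN hN hx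
    exact eq_zero_of_tvNorm_le_zero (by nlinarith [tvNorm_nonneg x])
  have hcont : Continuous fun x : S → ℝ => tvNorm (x ᵥ* P - x) :=
    continuous_tvNorm.comp ((continuous_id.matrix_vecMul continuous_const).sub continuous_id)
  obtain ⟨x, hx, hmin⟩ := (isCompact_stdSimplex ℝ S).exists_isMinOn
    ⟨_, single_mem_stdSimplex ℝ (Classical.arbitrary S)⟩ hcont.continuousOn
  have hfix : x ᵥ* P = x := by
    refine sub_eq_zero.1 (hzero _ (sum_sub_eq_zero (vecMul_mem_stdSimplex hP hx) hx) ?_)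
    refine (isMinOn_iff.1 hmin _ (vecMul_mem_stdSimplex hPN hx)).trans_eq ?_
    rw [Matrix.sub_vecMul, Matrix.vecMul_vecMul, Matrix.vecMul_vecMul, pow_mul_comm']
  have hpow : ∀ y : S → ℝ, y ᵥ* P = y → y ᵥ* P ^ N = y := fun y hy => by
    clear hN hPN hzero
    induction N with
    | zero => simp
    | succ N ih => rw [pow_succ, ← Matrix.vecMul_vecMul, ih, hy]
  refine ⟨x, ⟨hx, hfix⟩, fun y hy => sub_eq_zero.1 (hzero _ (sum_sub_eq_zero hy.1 hx) ?_)⟩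
  rw [Matrix.sub_vecMul, hpow y hy.2, hpow x hfix]

lemma tvNorm_vecMul_pow_mul_sub_stationaryDist_le {P : Matrix S S ℝ}
    (hP : P ∈ Matrix.rowStochastic ℝ S) {N : ℕ} {δ : ℝ}
    (hN : ∀ i j, δ ≤ (P ^ N) i j) (hδ : Fintype.card S * δ ≤ 1)
    (h : IsStationaryDist P (stationaryDist P))
    {ν : S → ℝ} (hν : ν ∈ stdSimplex ℝ S) (k : ℕ) :
    tvNorm (ν ᵥ* P ^ (N * k) - stationaryDist P) ≤ (1 - Fintype.card S * δ) ^ k := by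
  have hpow : ∀ n, stationaryDist P ᵥ* P ^ n = stationaryDist P := fun n => by
    induction n with
    | zero => simp
    | succ n ih => rw [pow_succ, ← Matrix.vecMul_vecMul, ih, h.2]
  induction k with
  | zero => simpa using tvNorm_sub_le_one hν h.1
  | succ k ih =>
    have e : ν ᵥ* P ^ (N * (k + 1)) - stationaryDist P
        = (ν ᵥ* P ^ (N * k) - stationaryDist P) ᵥ* P ^ N := by
      rw [Matrix.sub_vecMul, Matrix.vecMul_vecMul, hpow N, ← pow_add, mul_add, mul_one]
    rw [e, pow_succ']
    refine (tvNorm_vecMul_le_of_le (pow_mem hP N) hN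
      (sum_sub_eq_zero (vecMul_mem_stdSimplex (pow_mem hP _) hν) h.1)).trans ?_
    exact mul_le_mul_of_nonneg_left ih (by linarith)

/-! ### Mixing times -/

lemma mixingTime_le {P : Matrix S S ℝ} {ε : ℝ} {T : ℕ} (hT : 0 < T)
    (h : ∀ ν ∈ stdSimplex ℝ S, tvNorm (ν ᵥ* P ^ T - stationaryDist P) ≤ ε) :
    mixingTime P ε ≤ T :=
  sInf_le ⟨T, ⟨hT, h⟩, rfl⟩

lemma one_le_mixingTime (P : Matrix S S ℝ) (ε : ℝ) : 1 ≤ mixingTime P ε := by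
  refine le_sInf ?_
  rintro _ ⟨T, hT, rfl⟩
  exact Nat.one_le_cast.2 hT.1

lemma tvNorm_sub_stationaryDist_le_of_mixingTime_le {P : Matrix S S ℝ}
    (hP : P ∈ Matrix.rowStochastic ℝ S) {ε : ℝ} {m : ℕ} (hm : mixingTime P ε ≤ m)
    {ν : S → ℝ} (hν : ν ∈ stdSimplex ℝ S) :
    tvNorm (ν ᵥ* P ^ m - stationaryDist P) ≤ ε := by
  have hne : ((fun T : ℕ => (T : ℕ∞)) '' {T : ℕ | 0 < T ∧
      ∀ ν ∈ stdSimplex ℝ S, tvNorm (ν ᵥ* P ^ T - stationaryDist P) ≤ ε}).Nonempty := by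
    by_contra hne
    rw [Set.not_nonempty_iff_eq_empty] at hne
    rw [mixingTime, hne, sInf_empty] at hm
    exact absurd hm (by simp)
  obtain ⟨T, ⟨_, hT⟩, hTeq⟩ := csInf_mem hne
  have hle : T ≤ m := by
    have : (T : ℕ∞) ≤ m := hTeq.trans_le hm
    exact_mod_cast this
  have h := hT (ν ᵥ* P ^ (m - T)) (vecMul_mem_stdSimplex (pow_mem hP _) hν)
  rwa [Matrix.vecMul_vecMul, ← pow_add, Nat.sub_add_cancel hle] at h

/-! ### The interpolated chains -/

lemma interpMatrix_mem_rowStochastic {P₀ P₁ : Matrix S S ℝ}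
    (h₀ : P₀ ∈ Matrix.rowStochastic ℝ S) (h₁ : P₁ ∈ Matrix.rowStochastic ℝ S) {s : ℝ}
    (hs : s ∈ Set.Icc (0 : ℝ) 1) : interpMatrix P₀ P₁ s ∈ Matrix.rowStochastic ℝ S :=
  Matrix.convex_rowStochastic h₀ h₁ (by linarith [hs.2]) hs.1 (by ring)

lemma tvNorm_vecMul_interpMatrix_sub_le {P₀ P₁ : Matrix S S ℝ}
    (h₀ : P₀ ∈ Matrix.rowStochastic ℝ S) (h₁ : P₁ ∈ Matrix.rowStochastic ℝ S)
    {ν : S → ℝ} (hν : ν ∈ stdSimplex ℝ S) (a b : ℝ) :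
    tvNorm (ν ᵥ* interpMatrix P₀ P₁ a - ν ᵥ* interpMatrix P₀ P₁ b) ≤ |a - b| := by
  have e : ν ᵥ* interpMatrix P₀ P₁ a - ν ᵥ* interpMatrix P₀ P₁ b
      = (a - b) • (ν ᵥ* P₁ - ν ᵥ* P₀) := by
    simp only [interpMatrix, Matrix.vecMul_add, Matrix.vecMul_smul]
    module
  rw [e, tvNorm_smul]
  exact mul_le_of_le_one_right (abs_nonneg _)
    (tvNorm_sub_le_one (vecMul_mem_stdSimplex h₁ hν) (vecMul_mem_stdSimplex h₀ hν))

/-- The Doeblin condition holds uniformly along the interpolation. -/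
lemma exists_le_interpMatrix_pow [Nonempty S] {P₀ P₁ : Matrix S S ℝ}
    (h₀ : IsIrreducibleAperiodic P₀) (h₁ : IsIrreducibleAperiodic P₁) :
    ∃ N > 0, ∃ δ > 0, ∀ s ∈ Set.Icc (0 : ℝ) 1, ∀ i j, δ ≤ (interpMatrix P₀ P₁ s ^ N) i j := by
  obtain ⟨N₀, hN₀⟩ := h₀.exists_forall_ge_pow_pos
  obtain ⟨N₁, hN₁⟩ := h₁.exists_forall_ge_pow_pos
  set N := N₀ + N₁ + 1
  obtain ⟨p, hp⟩ := Finite.exists_min fun p : S × S =>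
    min ((P₀ ^ N) p.1 p.2) ((P₁ ^ N) p.1 p.2)
  have hpos : 0 < min ((P₀ ^ N) p.1 p.2) ((P₁ ^ N) p.1 p.2) :=
    lt_min (hN₀ N (by omega) _ _) (hN₁ N (by omega) _ _)
  refine ⟨N, by omega, (1 / 2) ^ N * min ((P₀ ^ N) p.1 p.2) ((P₁ ^ N) p.1 p.2), by positivity,
    fun s hs i j => ?_⟩
  have hn₀ := h₀.irreducible.nonneg
  have hn₁ := h₁.irreducible.nonneg
  have hij := hp (i, j)
  rcases le_total s (1 / 2) with h | h
  · refine le_trans (mul_le_mul_of_nonneg_left (hij.trans (min_le_left _ _)) (by positivity))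
      (pow_mul_pow_apply_le (by norm_num) hn₀ (fun k l => ?_) N i j)
    simp only [interpMatrix, Matrix.add_apply, Matrix.smul_apply, smul_eq_mul]
    nlinarith [hn₀ k l, mul_nonneg hs.1 (hn₁ k l)]
  · refine le_trans (mul_le_mul_of_nonneg_left (hij.trans (min_le_right _ _)) (by positivity))
      (pow_mul_pow_apply_le (by norm_num) hn₁ (fun k l => ?_) N i j)
    simp only [interpMatrix, Matrix.add_apply, Matrix.smul_apply, smul_eq_mul]
    nlinarith [hn₁ k l, mul_nonneg (sub_nonneg.2 hs.2) (hn₀ k l)]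

lemma existsUnique_isStationaryDist_interpMatrix [Nonempty S] {P₀ P₁ : Matrix S S ℝ}
    (h₀ : IsIrreducibleAperiodic P₀) (h₁ : IsIrreducibleAperiodic P₁) {s : ℝ}
    (hs : s ∈ Set.Icc (0 : ℝ) 1) : ∃! π : S → ℝ, IsStationaryDist (interpMatrix P₀ P₁ s) π := by
  obtain ⟨N, _, δ, hδ, h⟩ := exists_le_interpMatrix_pow h₀ h₁
  exact existsUnique_isStationaryDist
    (interpMatrix_mem_rowStochastic h₀.stochastic h₁.stochastic hs) hδ (h s hs)

lemma maxMixingTime_ne_top [Nonempty S] {P₀ P₁ : Matrix S S ℝ}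
    (h₀ : IsIrreducibleAperiodic P₀) (h₁ : IsIrreducibleAperiodic P₁) {ε : ℝ} (hε : 0 < ε) :
    maxMixingTime P₀ P₁ ε ≠ ⊤ := by
  obtain ⟨N, hN, δ, hδ, h⟩ := exists_le_interpMatrix_pow h₀ h₁
  have hst : ∀ s ∈ Set.Icc (0 : ℝ) 1, interpMatrix P₀ P₁ s ∈ Matrix.rowStochastic ℝ S :=
    fun s hs => interpMatrix_mem_rowStochastic h₀.stochastic h₁.stochastic hs
  have hcard : 0 < (Fintype.card S : ℝ) * δ := mul_pos (by exact_mod_cast Fintype.card_pos) hδ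
  have hle : (Fintype.card S : ℝ) * δ ≤ 1 := by
    have h0 : (0 : ℝ) ∈ Set.Icc (0 : ℝ) 1 := by simp
    rw [← Matrix.sum_row_of_mem_rowStochastic (pow_mem (hst 0 h0) N) (Classical.arbitrary S),
      ← nsmul_eq_mul]
    exact Finset.card_nsmul_le_sum _ _ _ fun j _ => h 0 h0 _ j
  obtain ⟨k, hk⟩ := exists_pow_lt_of_lt_one hε (show 1 - (Fintype.card S : ℝ) * δ < 1 by linarith)
  have hk' : (1 - (Fintype.card S : ℝ) * δ) ^ (k + 1) ≤ ε :=
    (pow_le_pow_of_le_one (by linarith) (by linarith) k.le_succ).trans hk.le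
  refine ne_top_of_le_ne_top (ENat.natCast_ne_top (N * (k + 1))) (iSup₂_le fun s hs => ?_)
  refine mixingTime_le (by positivity) fun ν hν => ?_
  exact (tvNorm_vecMul_pow_mul_sub_stationaryDist_le (hst s hs) (h s hs) hle
    (isStationaryDist_stationaryDist (existsUnique_isStationaryDist_interpMatrix h₀ h₁ hs))
    hν (k + 1)).trans hk'

lemma one_le_maxMixingTime (P₀ P₁ : Matrix S S ℝ) (ε : ℝ) : 1 ≤ maxMixingTime P₀ P₁ ε :=
  (one_le_mixingTime _ ε).trans
    (le_iSup₂_of_le (f := fun s (_ : s ∈ Set.Icc (0 : ℝ) 1) => mixingTime (interpMatrix P₀ P₁ s) ε)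
      0 (by simp) le_rfl)

/-! ### The adiabatic evolution -/

/-- Replacing the matrices `P_{a 0}, …, P_{a (m - 1)}` of a time-inhomogeneous evolution by the
single matrix `P_b` costs at most the sum of the parameter distances. -/
lemma tvNorm_sub_vecMul_interpMatrix_pow_le {P₀ P₁ : Matrix S S ℝ}
    (h₀ : P₀ ∈ Matrix.rowStochastic ℝ S) (h₁ : P₁ ∈ Matrix.rowStochastic ℝ S)
    {D : ℕ → S → ℝ} {a : ℕ → ℝ} {b : ℝ} (hb : b ∈ Set.Icc (0 : ℝ) 1)
    (m : ℕ) (hD : ∀ j < m, D j ∈ stdSimplex ℝ S)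
    (hstep : ∀ j < m, D (j + 1) = D j ᵥ* interpMatrix P₀ P₁ (a j)) :
    tvNorm (D m - D 0 ᵥ* interpMatrix P₀ P₁ b ^ m) ≤ ∑ j ∈ Finset.range m, |a j - b| := by
  induction m with
  | zero => simp [tvNorm]
  | succ m ih =>
    have e : D (m + 1) - D 0 ᵥ* interpMatrix P₀ P₁ b ^ (m + 1)
        = (D m - D 0 ᵥ* interpMatrix P₀ P₁ b ^ m) ᵥ* interpMatrix P₀ P₁ b
          + (D m ᵥ* interpMatrix P₀ P₁ (a m) - D m ᵥ* interpMatrix P₀ P₁ b) := by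
      rw [hstep m m.lt_succ_self, Matrix.sub_vecMul, Matrix.vecMul_vecMul, ← pow_succ]
      abel
    rw [e, Finset.sum_range_succ]
    refine (tvNorm_add_le _ _).trans (add_le_add ?_ ?_)
    · exact (tvNorm_vecMul_le (interpMatrix_mem_rowStochastic h₀ h₁ hb) _).trans
        (ih (fun j hj => hD j (by omega)) fun j hj => hstep j (by omega))
    · exact tvNorm_vecMul_interpMatrix_sub_le h₀ h₁ (hD m m.lt_succ_self) _ _

lemma adiabaticDist_mem_stdSimplex {P₀ P₁ : Matrix S S ℝ}
    (h₀ : P₀ ∈ Matrix.rowStochastic ℝ S) (h₁ : P₁ ∈ Matrix.rowStochastic ℝ S)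
    (hπ : IsStationaryDist P₀ (stationaryDist P₀)) {T k : ℕ} (hk : k ≤ T) :
    adiabaticDist P₀ P₁ T k ∈ stdSimplex ℝ S := by
  induction k with
  | zero => exact hπ.1
  | succ k ih =>
    refine vecMul_mem_stdSimplex (interpMatrix_mem_rowStochastic h₀ h₁ ⟨by positivity, ?_⟩)
      (ih (by omega))
    exact div_le_one_of_le₀ (by exact_mod_cast hk) (by positivity)

/-- The last `m` steps of the adiabatic evolution up to time `k` compared with `m` steps of the
chain `P_{k/T}`. In `k - m` the subtraction is truncated: for `k < m` the evolution starts with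
`m - k` idle steps `π₀ P₀ = π₀`. -/
lemma tvNorm_adiabaticDist_sub_le {P₀ P₁ : Matrix S S ℝ}
    (h₀ : P₀ ∈ Matrix.rowStochastic ℝ S) (h₁ : P₁ ∈ Matrix.rowStochastic ℝ S)
    (hπ : IsStationaryDist P₀ (stationaryDist P₀)) {T k : ℕ} (hT : 0 < T) (hk : k ≤ T) (m : ℕ) :
    tvNorm (adiabaticDist P₀ P₁ T k
      - adiabaticDist P₀ P₁ T (k - m) ᵥ* interpMatrix P₀ P₁ ((k : ℝ) / (T : ℝ)) ^ m)
      ≤ (m : ℝ) * (m - 1) / (2 * T) := by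
  have hT' : (0 : ℝ) < T := by exact_mod_cast hT
  have hmain := tvNorm_sub_vecMul_interpMatrix_pow_le h₀ h₁
    (D := fun j => adiabaticDist P₀ P₁ T (k + j - m))
    (a := fun j => ((k + j + 1 - m : ℕ) : ℝ) / T) (b := (k : ℝ) / T)
    ⟨by positivity, div_le_one_of_le₀ (by exact_mod_cast hk) hT'.le⟩ m
    (fun j hj => adiabaticDist_mem_stdSimplex h₀ h₁ hπ (by omega)) (fun j hj => by
      rcases Nat.lt_or_ge (k + j) m with h | h
      · have e : interpMatrix P₀ P₁ 0 = P₀ := by simp [interpMatrix]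
        have e₁ : k + (j + 1) - m = 0 := by omega
        have e₂ : k + j - m = 0 := by omega
        have e₃ : k + j + 1 - m = 0 := by omega
        simp only [e₁, e₂, e₃, adiabaticDist, Nat.cast_zero, zero_div, e, hπ.2]
      · have e₁ : k + (j + 1) - m = (k + j - m) + 1 := by omega
        have e₃ : k + j + 1 - m = (k + j - m) + 1 := by omega
        simp only [e₁, e₃, adiabaticDist])
  simp only [Nat.add_sub_cancel, Nat.add_zero] at hmain
  refine hmain.trans ?_
  have hterm : ∀ j ∈ Finset.range m,
      |((k + j + 1 - m : ℕ) : ℝ) / T - (k : ℝ) / T| ≤ ((m : ℝ) - 1 - j) / T := fun j hj => by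
    have hj := Finset.mem_range.1 hj
    have hle : k + j + 1 - m ≤ k := by omega
    have hge : (k : ℝ) + j + 1 ≤ (k + j + 1 - m : ℕ) + m := by
      exact_mod_cast Nat.le_add_of_sub_le le_rfl
    rw [← sub_div, abs_div, abs_of_pos hT', abs_sub_comm,
      abs_of_nonneg (sub_nonneg.2 (by exact_mod_cast hle))]
    exact div_le_div_of_nonneg_right (by linarith) hT'.le
  have hsum : ∀ (c : ℝ) (n : ℕ),
      ∑ j ∈ Finset.range n, (c - j) / T = (n * c - n * (n - 1) / 2) / T := fun c n => by
    induction n with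
    | zero => simp
    | succ n ih =>
      rw [Finset.sum_range_succ, ih]
      push_cast
      ring
  refine (Finset.sum_le_sum hterm).trans_eq ?_
  rw [hsum]
  field_simp
  ring

lemma stableAdiabaticTime_le [Nonempty S] {P₀ P₁ : Matrix S S ℝ}
    (h₀ : IsIrreducibleAperiodic P₀) (h₁ : IsIrreducibleAperiodic P₁) {ε : ℝ} {m T : ℕ}
    (hm : maxMixingTime P₀ P₁ (ε / 2) ≤ m) (hT : 0 < T)
    (h : (m : ℝ) * (m - 1) < ε * T) : stableAdiabaticTime P₀ P₁ ε ≤ T := by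
  have hT' : (0 : ℝ) < T := by exact_mod_cast hT
  have e : interpMatrix P₀ P₁ 0 = P₀ := by simp [interpMatrix]
  have hπ : IsStationaryDist P₀ (stationaryDist P₀) := by
    have := isStationaryDist_stationaryDist
      (existsUnique_isStationaryDist_interpMatrix h₀ h₁ (s := 0) (by simp))
    rwa [e] at this
  refine sInf_le ⟨T, ⟨hT, fun k _ hk => ?_⟩, rfl⟩
  have hs : (k : ℝ) / T ∈ Set.Icc (0 : ℝ) 1 :=
    ⟨by positivity, div_le_one_of_le₀ (by exact_mod_cast hk) hT'.le⟩
  have hmix := tvNorm_sub_stationaryDist_le_of_mixingTime_le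
    (interpMatrix_mem_rowStochastic h₀.stochastic h₁.stochastic hs)
    ((le_iSup₂ (f := fun s (_ : s ∈ Set.Icc (0 : ℝ) 1) =>
      mixingTime (interpMatrix P₀ P₁ s) (ε / 2)) _ hs).trans hm)
    (adiabaticDist_mem_stdSimplex h₀.stochastic h₁.stochastic hπ (T := T) (k := k - m) (by omega))
  have hdiff := tvNorm_adiabaticDist_sub_le h₀.stochastic h₁.stochastic hπ hT hk m
  have hlt : (m : ℝ) * (m - 1) / (2 * T) < ε / 2 := by
    rw [div_lt_iff₀ (by positivity)]
    linarith
  have htri := tvNorm_add_le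
    (adiabaticDist P₀ P₁ T k
      - adiabaticDist P₀ P₁ T (k - m) ᵥ* interpMatrix P₀ P₁ ((k : ℝ) / (T : ℝ)) ^ m)
    (adiabaticDist P₀ P₁ T (k - m) ᵥ* interpMatrix P₀ P₁ ((k : ℝ) / (T : ℝ)) ^ m
      - stationaryDist (interpMatrix P₀ P₁ ((k : ℝ) / (T : ℝ))))
  rw [sub_add_sub_cancel] at htri
  linarith

end

theorem theorem3 :
    ∀ ε₀ : ℝ, 0 < ε₀ → ∃ C : ℝ, 0 < C ∧
      ∀ (n : ℕ), 0 < n → ∀ (P₀ P₁ : Matrix (Fin n) (Fin n) ℝ),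
        IsIrreducibleAperiodic P₀ → IsIrreducibleAperiodic P₁ →
        (∀ s ∈ Set.Icc (0 : ℝ) 1, ∃! π : Fin n → ℝ,
          IsStationaryDist (interpMatrix P₀ P₁ s) π) ∧
        ∀ ε : ℝ, 0 < ε → ε ≤ ε₀ → ∃ tmix tsad : ℕ,
          maxMixingTime P₀ P₁ (ε / 2) = (tmix : ℕ∞) ∧
          stableAdiabaticTime P₀ P₁ ε = (tsad : ℕ∞) ∧
          (tsad : ℝ) ≤ C * ((tmix : ℝ) ^ 4 / ε ^ 3) ∧
          (ε ≤ 1 → (tsad : ℝ) ≤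
            4 * (tmix : ℝ) ^ 4 / ε ^ 3 + 4 * (tmix : ℝ) ^ 2 / ε ^ 2 + 1 / ε) := by
  intro ε₀ hε₀
  refine ⟨ε₀ ^ 2 + ε₀ ^ 3, by positivity, fun n hn P₀ P₁ h₀ h₁ => ?_⟩
  have : Nonempty (Fin n) := ⟨⟨0, hn⟩⟩
  refine ⟨fun s hs => existsUnique_isStationaryDist_interpMatrix h₀ h₁ hs, fun ε hε hεε₀ => ?_⟩
  obtain ⟨m, hm⟩ := ENat.ne_top_iff_exists.1 (maxMixingTime_ne_top h₀ h₁ (half_pos hε))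
  have hm1 : (1 : ℝ) ≤ m := by
    have := one_le_maxMixingTime P₀ P₁ (ε / 2)
    rw [← hm] at this
    exact_mod_cast this
  -- `T` is the least integer exceeding `m (m - 1) / ε`
  obtain ⟨T, hTdef⟩ : ∃ T : ℕ, T = ⌊(m : ℝ) * (m - 1) / ε⌋₊ + 1 := ⟨_, rfl⟩
  have hmm : 0 ≤ (m : ℝ) * (m - 1) / ε :=
    div_nonneg (mul_nonneg (by linarith) (by linarith)) hε.le
  have hTlt : (m : ℝ) * (m - 1) < ε * T := by
    rw [mul_comm ε, ← div_lt_iff₀ hε, hTdef]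
    exact_mod_cast Nat.lt_floor_add_one _
  have hTle : (T : ℝ) ≤ m * (m - 1) / ε + 1 := by
    rw [hTdef]
    push_cast
    linarith [Nat.floor_le hmm]
  have hsad := stableAdiabaticTime_le h₀ h₁ hm.ge (by omega) hTlt
  obtain ⟨t, ht⟩ := ENat.ne_top_iff_exists.1 (ne_top_of_le_ne_top (ENat.natCast_ne_top T) hsad)
  have htT : (t : ℝ) ≤ T := by
    rw [← ht] at hsad
    exact_mod_cast hsad
  refine ⟨m, t, hm.symm, ht.symm, ?_, fun hε1 => ?_⟩
  · have hm4 : (m : ℝ) ^ 2 ≤ m ^ 4 := pow_le_pow_right₀ hm1 (by norm_num)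
    have h2 : ε ^ 2 ≤ ε₀ ^ 2 := by gcongr
    have h3 : ε ^ 3 ≤ ε₀ ^ 3 := by gcongr
    calc (t : ℝ) ≤ m * (m - 1) / ε + 1 := htT.trans hTle
      _ ≤ m ^ 4 / ε + m ^ 4 :=
        add_le_add (div_le_div_of_nonneg_right (by nlinarith) hε.le) (one_le_pow₀ hm1)
      _ = (ε ^ 2 + ε ^ 3) * (m ^ 4 / ε ^ 3) := by field_simp
      _ ≤ (ε₀ ^ 2 + ε₀ ^ 3) * (m ^ 4 / ε ^ 3) := by gcongr
  · have h1 : (1 : ℝ) ≤ 1 / ε := (one_le_div hε).2 hε1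
    have h2 : (m : ℝ) * (m - 1) / ε ≤ 4 * m ^ 2 / ε ^ 2 :=
      div_le_div₀ (by positivity) (by nlinarith) (by positivity) (by nlinarith)
    have h3 : 0 ≤ 4 * (m : ℝ) ^ 4 / ε ^ 3 := by positivity
    linarith
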